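/- Let $\mathbb{K}$ be a field of characteristic zero, let $n\ge 0$, and let $R_n=\mathbb{K}[H_{ij} : 1\le i<j\le n]$ be the polynomial ring in $\binom n2$ variables with the $\mathbb{Z}^n$-grading $\deg H_{ij}=\mathbf{e}_i+\mathbf{e}_j$. Let $A\in\mathbb{Z}^{n\times\binom n2}$ be the matrix whose columns are the vectors $\mathbf{e}_i+\mathbf{e}_j$, $i<j$ (the incidence matrix of the complete graph $K_n$). For $\mathbf{b}=(b_1,\dots,b_n)\in\mathbb{Z}_{\ge 0}^n$ let $h_{R_n}(\mathbf{b})=\dim_{\mathbb{K}}(R_n)_{\mathbf{b}}$ be the Hilbert function, let $$\varphi_A(\mathbf{b})=\bigl|\{x\in\mathbb{Z}_{\ge0}^{\binom n2} : Ax=\mathbf{b}\}\bigr|$$ be the vector partition function of $A$, and let $$\mathcal{P}(K_n,\mathbf{b})=\Bigl\{x\in\mathbb{R}_{\ge 0}^{E(K_n)} : \sum_{e\ni v}x_e=b_v \text{ for every vertex } v\Bigr\}$$ be the fractional perfect $\mathbf{b}$-matching polytope of $K_n$. Then these numbers are finite and $$h_{R_n}(\mathbf{b})=\varphi_A(\mathbf{b})=\bigl|\mathcal{P}(K_n,\mathbf{b})\cap\mathbb{Z}^{E(K_n)}\bigr|.$$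 Moreover, $$h_{R_n}(\mathbf{b})=\sum_{\lambda}K_{\lambda,\mathbf{b}},$$ where $\lambda$ runs over the partitions of $|\mathbf{b}|=b_1+\dots+b_n$ whose conjugate partition $\lambda'$ has only even parts, and the Kostka number $K_{\lambda,\mathbf{b}}$ is the number of semistandard Young tableaux of shape $\lambda$ with entries in $\{1,\dots,n\}$ in which each $k$ occurs exactly $b_k$ times. -/

import Mathlib

namespace ConformalCounting

section Grading

variable {m σ : Type*}

/-- The homogeneous component of multidegree `a` of the polynomial ring `K[x_e : e ∈ σ]`, for the
`ℤ^m`-grading in which the variable `x_e` has degree equal to the column `e` of `B`: the span of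
the monomials `x^u` with `B u = a`. -/
noncomputable def gradedPiece (K : Type*) [Field K] (B : Matrix m σ ℤ) (a : m → ℤ) :
    Submodule K (MvPolynomial σ K) :=
  MvPolynomial.weightedHomogeneousSubmodule K (fun e : σ => fun k : m => B k e) a

/-- The multigraded Hilbert function `a ↦ dim_K R_a` of `R = K[x_e : e ∈ σ]`, graded by `B`. -/
noncomputable def hilbertFunction (K : Type*) [Field K] (B : Matrix m σ ℤ) (a : m → ℤ) : ℕ :=
  Module.finrank K (gradedPiece K B a)

/-- The vectors `x` with non-negative integer entries such that `B x = a`. -/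
def partitionVectors [Fintype σ] (B : Matrix m σ ℤ) (a : m → ℤ) : Set (σ → ℕ) :=
  {x | B.mulVec (fun e => (x e : ℤ)) = a}

/-- The vector partition function `φ_B` of an integer matrix `B`. -/
noncomputable def vectorPartitionFunction [Fintype σ] (B : Matrix m σ ℤ) (a : m → ℤ) : ℕ :=
  (partitionVectors B a).ncard

end Grading

/-- The index set `{(i, j) : i < j}` of the variables `H_{ij}`. -/
abbrev PairIndex (n : ℕ) : Type := {p : Fin n × Fin n // p.1 < p.2}

/-- The `n × (n choose 2)` matrix whose column at `(i, j)` is `e_i + e_j`, where `i < j`. -/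
def matrixA (n : ℕ) : Matrix (Fin n) (PairIndex n) ℤ :=
  fun k p => if k = p.1.1 ∨ k = p.1.2 then 1 else 0

/-- The fractional perfect `s`-matching polytope of the graph `G`, in `ℝ^E`. -/
def perfectMatchingPolytope {V : Type*} [DecidableEq V] (G : SimpleGraph V) [Fintype G.edgeSet]
    (s : V → ℕ) : Set (G.edgeSet → ℝ) :=
  {x | (∀ e, 0 ≤ x e) ∧ ∀ v, ∑ e : G.edgeSet, (if v ∈ (e : Sym2 V) then x e else 0) = (s v : ℝ)}

/-- The points of `P ⊆ ℝ^E` with integer coordinates. -/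
def latticePoints {E : Type*} (P : Set (E → ℝ)) : Set (E → ℝ) :=
  P ∩ {x | ∀ e, ∃ z : ℤ, x e = (z : ℝ)}

/-- There are finitely many Young diagrams with `N` cells. -/
theorem finite_diagrams (N : ℕ) : {μ : YoungDiagram | μ.card = N}.Finite := by
  have hinj : Function.Injective YoungDiagram.cells := fun a b h => YoungDiagram.ext h
  refine Set.Finite.of_finite_image (f := YoungDiagram.cells) ?_ hinj.injOn
  refine (Finset.finite_toSet (Finset.range N ×ˢ Finset.range N).powerset).subset ?_
  rintro _ ⟨μ, hμ, rfl⟩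
  simp only [Set.mem_ofPred_eq] at hμ
  rw [Finset.mem_coe, Finset.mem_powerset]
  rintro ⟨i, j⟩ hc
  rw [YoungDiagram.mem_cells] at hc
  have h1 : i < μ.colLen j := YoungDiagram.mem_iff_lt_colLen.1 hc
  have h2 : j < μ.rowLen i := YoungDiagram.mem_iff_lt_rowLen.1 hc
  have h3 : μ.colLen j ≤ μ.card := by
    rw [YoungDiagram.colLen_eq_card]
    exact Finset.card_le_card (Finset.filter_subset _ _)
  have h4 : μ.rowLen i ≤ μ.card := by
    rw [YoungDiagram.rowLen_eq_card]
    exact Finset.card_le_card (Finset.filter_subset _ _)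
  simp only [Finset.mem_product, Finset.mem_range]
  omega

/-- The partitions of `N`, each given by its Young diagram. -/
noncomputable def partitionsOf (N : ℕ) : Finset YoungDiagram := (finite_diagrams N).toFinset

/-- A partition is even if all its parts (the row lengths of its diagram) are even. -/
def IsEvenPartition (μ : YoungDiagram) : Prop := ∀ i, Even (μ.rowLen i)

open Classical in
/-- The partitions of `N` whose conjugate partition is even. -/
noncomputable def evenConjugatePartitions (N : ℕ) : Finset YoungDiagram :=
  (partitionsOf N).filter fun μ => IsEvenPartition μ.transpose

/-- The semistandard Young tableaux of shape `μ` and weight `b`: all entries are in `{1, …, n}`,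
and the `k`-th of these values occurs `b k` times (`Fin n` starts at `0`, whence `k + 1`). -/
def tableauxOfWeight {n : ℕ} (μ : YoungDiagram) (b : Fin n → ℕ) :
    Set (SemistandardYoungTableau μ) :=
  {T | (∀ c ∈ μ.cells, 1 ≤ T c.1 c.2 ∧ T c.1 c.2 ≤ n) ∧
    ∀ k : Fin n, (μ.cells.filter fun c => T c.1 c.2 = (k : ℕ) + 1).card = b k}

/-- There are finitely many tableaux of given shape and weight. -/
theorem finite_tableauxOfWeight {n : ℕ} (μ : YoungDiagram) (b : Fin n → ℕ) :
    (tableauxOfWeight μ b).Finite := by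
  let f : tableauxOfWeight μ b → (μ.cells → Fin (n + 1)) := fun T c =>
    ⟨T.1 c.1.1 c.1.2, Nat.lt_succ_of_le (T.2.1 c.1 c.2).2⟩
  have hf : Function.Injective f := by
    intro T T' h
    apply Subtype.ext
    apply SemistandardYoungTableau.ext
    intro i j
    by_cases hc : (i, j) ∈ μ
    · have := congrFun h ⟨(i, j), (YoungDiagram.mem_cells _).2 hc⟩
      exact congrArg Fin.val this
    · rw [T.1.zeros hc, T'.1.zeros hc]
  exact (Finite.of_injective f hf : Finite (tableauxOfWeight μ b))

/-- The Kostka number `K_{μ,b}`. -/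
noncomputable def kostka {n : ℕ} (μ : YoungDiagram) (b : Fin n → ℕ) : ℕ :=
  (tableauxOfWeight μ b).ncard

end ConformalCounting

open ConformalCounting

/-! The first equalities are bookkeeping: monomials of multidegree b form a basis of the graded
piece, their exponents are the solutions of Ax = b, and these are the lattice points of the polytope
once pairs i < j are identified with edges. The Kostka sum needs an argument. A solution x is a
loopless multigraph with degrees b. Deleting the last vertex leaves a multigraph whose degrees have
dropped by a vector c of total size b_n (`tsum_pairDegree_succ`). The sum of Kostka numbers over
shapes with even columns obeys the same recursion (`tsum_evenColumns_kostka_succ`). Removing the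
largest entries of a tableau takes a horizontal strip off its shape (`kostka_branching`); removing a
strip from an even-column shape can be traded for adding one to an even-column shape
(`tsum_evenColumns_strip`); and adding a strip amounts to decreasing the weight, by Pieri
(`tsum_strip_mul_kostka`). Pieri itself follows by induction on n from a commutation rule for adding
and removing strips (`tsum_strip_commute`). Counts are sums of indicators in `ℝ≥0∞`, so sums over
all diagrams can be interchanged without convergence conditions. -/

namespace ConformalCounting

open scoped ENNReal

/-! ### Counting by sums of indicators -/

section Indicator

open Classical in
/-- The indicator of a proposition, with values in `ℝ≥0∞`. -/
noncomputable def ind (p : Prop) : ℝ≥0∞ := if p then 1 else 0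

theorem ind_of_true {p : Prop} (h : p) : ind p = 1 := if_pos h

theorem ind_of_false {p : Prop} (h : ¬p) : ind p = 0 := if_neg h

theorem ind_and (p q : Prop) : ind (p ∧ q) = ind p * ind q := by
  by_cases hp : p <;> by_cases hq : q <;> simp [ind, hp, hq]

theorem ind_congr {p q : Prop} (h : p ↔ q) : ind p = ind q := by rw [propext h]

theorem tsum_ind_mul {α : Type*} (P : α → Prop) (f : α → ℝ≥0∞) :
    ∑' a, ind (P a) * f a = ∑' a : {a // P a}, f a := by
  change _ = ∑' a : ({a | P a} : Set α), f a
  rw [tsum_subtype]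
  refine tsum_congr fun a => ?_
  by_cases ha : P a <;> simp [ind, Set.indicator, ha]

/-- Indicator sums that correspond under a bijective relation of their supports agree. -/
theorem tsum_ind_mul_bij {α β : Type*} {P : α → Prop} {Q : β → Prop} {f : α → ℝ≥0∞}
    {g : β → ℝ≥0∞} (R : α → β → Prop) (hl : ∀ a, P a → ∃ b, Q b ∧ R a b)
    (hr : ∀ b, Q b → ∃ a, P a ∧ R a b)
    (ul : ∀ a b b', Q b → Q b' → R a b → R a b' → b = b')
    (ur : ∀ a a' b, P a → P a' → R a b → R a' b → a = a')
    (h : ∀ a b, P a → Q b → R a b → f a = g b) :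
    ∑' a, ind (P a) * f a = ∑' b, ind (Q b) * g b := by
  rw [tsum_ind_mul, tsum_ind_mul]
  choose i hiQ hiR using hl
  choose j hjP hjR using hr
  let e : {a // P a} ≃ {b // Q b} :=
    ⟨fun a => ⟨i a a.2, hiQ a a.2⟩, fun b => ⟨j b b.2, hjP b b.2⟩,
      fun a => Subtype.ext (ur _ _ (i a a.2) (hjP _ _) a.2 (hjR _ _) (hiR _ _)),
      fun b => Subtype.ext (ul (j b b.2) _ _ (hiQ _ _) b.2 (hiR _ _) (hjR _ _))⟩
  rw [← e.tsum_eq fun b => g b]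
  exact tsum_congr fun a => h _ _ a.2 (hiQ _ _) (hiR _ _)

/-- With a relation in place of a pair of maps, existence on each side and uniqueness on each side
are separate goals, and no inverse has to be computed. -/
theorem tsum_ind_bij {α β : Type*} {P : α → Prop} {Q : β → Prop}
    (R : α → β → Prop) (hl : ∀ a, P a → ∃ b, Q b ∧ R a b)
    (hr : ∀ b, Q b → ∃ a, P a ∧ R a b)
    (ul : ∀ a b b', Q b → Q b' → R a b → R a b' → b = b')
    (ur : ∀ a a' b, P a → P a' → R a b → R a' b → a = a') :
    ∑' a, ind (P a) = ∑' b, ind (Q b) := by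
  simpa using tsum_ind_mul_bij (f := fun _ => 1) (g := fun _ => 1) R hl hr ul ur
    fun _ _ _ _ _ => rfl

theorem natCast_ncard_eq_tsum {α : Type*} {s : Set α} (hs : s.Finite) :
    (s.ncard : ℝ≥0∞) = ∑' a, ind (a ∈ s) := by
  have h : ∑' a, ind (a ∈ s) = ∑' _ : s, (1 : ℝ≥0∞) := by
    rw [tsum_subtype s (fun _ => (1 : ℝ≥0∞))]
    refine tsum_congr fun c => ?_
    by_cases hc : c ∈ s <;> simp [ind, hc]
  rw [h, ENNReal.tsum_set_one, ← hs.cast_ncard_eq]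
  rfl

end Indicator

/-! ### Young diagrams through their row lengths -/

section Rows

theorem diagram_ext_rowLen {μ ν : YoungDiagram} (h : ∀ i, μ.rowLen i = ν.rowLen i) : μ = ν := by
  apply YoungDiagram.ext
  ext ⟨i, j⟩
  rw [YoungDiagram.mem_cells, YoungDiagram.mem_cells, YoungDiagram.mem_iff_lt_rowLen,
    YoungDiagram.mem_iff_lt_rowLen, h]

theorem rowLen_eq_zero {μ : YoungDiagram} {i : ℕ} (h : μ.colLen 0 ≤ i) : μ.rowLen i = 0 := by
  by_contra h0
  have : (i, 0) ∈ μ := YoungDiagram.mem_iff_lt_rowLen.2 (Nat.pos_of_ne_zero h0)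
  have := YoungDiagram.mem_iff_lt_colLen.1 this
  omega

theorem card_eq_sum_rowLen {μ : YoungDiagram} {N : ℕ} (h : μ.colLen 0 ≤ N) :
    μ.card = ∑ i ∈ Finset.range N, μ.rowLen i := by
  have hm : ∀ c ∈ μ.cells, c.1 ∈ Finset.range N := by
    rintro ⟨i, j⟩ hc
    have hc' : (i, j) ∈ μ := hc
    have h1 : (i, 0) ∈ μ := μ.up_left_mem le_rfl (Nat.zero_le j) hc'
    have := YoungDiagram.mem_iff_lt_colLen.1 h1
    exact Finset.mem_range.2 (by omega)
  rw [YoungDiagram.card, Finset.card_eq_sum_card_fiberwise hm]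
  exact Finset.sum_congr rfl fun i _ => (YoungDiagram.rowLen_eq_card μ).symm

open Classical in
/-- The diagram with given row lengths (junk unless they decrease to zero). -/
noncomputable def ofRows (f : ℕ → ℕ) : YoungDiagram :=
  if h : Antitone f ∧ ∃ N, f N = 0 then
    { cells := (Finset.range h.2.choose ×ˢ Finset.range (f 0)).filter fun c => c.2 < f c.1
      isLowerSet := by
        rintro ⟨i, j⟩ ⟨i', j'⟩ ⟨h1, h2⟩ hc
        simp only [Finset.coe_filter, Finset.mem_product, Finset.mem_range,
          Set.mem_ofPred_eq] at hc h1 h2 ⊢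
        have := h.1 h1
        omega }
  else ⊥

theorem rowLen_ofRows {f : ℕ → ℕ} (hf : Antitone f) (hN : ∃ N, f N = 0) (i : ℕ) :
    (ofRows f).rowLen i = f i := by
  have key : ∀ j, (i, j) ∈ ofRows f ↔ j < f i := by
    intro j
    rw [ofRows, dif_pos ⟨hf, hN⟩, ← YoungDiagram.mem_cells]
    simp only [Finset.mem_filter, Finset.mem_product, Finset.mem_range]
    refine ⟨fun h => h.2, fun h => ⟨⟨?_, h.trans_le (hf (Nat.zero_le i))⟩, h⟩⟩
    by_contra hlt
    have h1 := hf (not_lt.1 hlt)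
    rw [hN.choose_spec] at h1
    omega
  have h1 := (key ((ofRows f).rowLen i)).2.mt
  have h2 := (key (f i)).1.mt
  rw [YoungDiagram.mem_iff_lt_rowLen] at h1 h2
  exact le_antisymm (not_lt.1 (h2 (lt_irrefl _))) (not_lt.1 (h1 (lt_irrefl _)))

theorem rowLen_succ_le (μ : YoungDiagram) (i : ℕ) : μ.rowLen (i + 1) ≤ μ.rowLen i :=
  μ.rowLen_anti _ _ (Nat.le_succ i)

end Rows

/-! ### Horizontal strips and their commutation rule -/

section Strips

/-- The skew shape `lam / μ` is a horizontal strip with `k` cells. -/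
structure IsStrip (k : ℕ) (μ lam : YoungDiagram) : Prop where
  le (i : ℕ) : μ.rowLen i ≤ lam.rowLen i
  interlace (i : ℕ) : lam.rowLen (i + 1) ≤ μ.rowLen i
  card_eq : lam.card = μ.card + k

theorem card_le_card_of_rowLen_le {μ ν : YoungDiagram} (h : ∀ i, μ.rowLen i ≤ ν.rowLen i) :
    μ.card ≤ ν.card := by
  refine Finset.card_le_card ?_
  rintro ⟨i, j⟩ hc
  rw [YoungDiagram.mem_cells, YoungDiagram.mem_iff_lt_rowLen] at hc ⊢
  exact hc.trans_le (h i)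

/-- The local rule: row `i + 1` of `κ` is the reflection of row `i` of `ρ` in the interval that the
interlacing conditions with `μ` and `ν` prescribe for both. -/
structure Reflected (μ ν : YoungDiagram) (κ : YoungDiagram) (p : ℕ × YoungDiagram) : Prop where
  zero : κ.rowLen 0 = max (μ.rowLen 0) (ν.rowLen 0) + p.1
  succ (i : ℕ) : κ.rowLen (i + 1) + p.2.rowLen i =
    min (μ.rowLen i) (ν.rowLen i) + max (μ.rowLen (i + 1)) (ν.rowLen (i + 1))

/-- The row equations telescope because min + max is the sum. This fixes the sizes of the reflected
strips: if `κ` exceeds `μ` by k cells, then `ν` exceeds `p.2` by k - `p.1`. -/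
theorem Reflected.card_add_card {μ ν κ : YoungDiagram} {p : ℕ × YoungDiagram}
    (h : Reflected μ ν κ p) : κ.card + p.2.card = μ.card + ν.card + p.1 := by
  set N := μ.colLen 0 + ν.colLen 0 + κ.colLen 0 + p.2.colLen 0 with hN
  rw [card_eq_sum_rowLen (μ := κ) (N := N + 1) (by omega),
    card_eq_sum_rowLen (μ := p.2) (N := N) (by omega),
    card_eq_sum_rowLen (μ := μ) (N := N + 1) (by omega),
    card_eq_sum_rowLen (μ := ν) (N := N + 1) (by omega)]
  -- The minimum in row M is not yet paired with a maximum; it vanishes once M is past the last row.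
  have key : ∀ M, ∑ i ∈ Finset.range (M + 1), κ.rowLen i + ∑ i ∈ Finset.range M, p.2.rowLen i
      + min (μ.rowLen M) (ν.rowLen M) =
      ∑ i ∈ Finset.range (M + 1), μ.rowLen i + ∑ i ∈ Finset.range (M + 1), ν.rowLen i + p.1 := by
    intro M
    induction M with
    | zero =>
      have := h.zero
      simp only [zero_add, Finset.sum_range_one, Finset.sum_range_zero]
      omega
    | succ M ih =>
      rw [Finset.sum_range_succ _ (M + 1), Finset.sum_range_succ (fun i => p.2.rowLen i) M,
        Finset.sum_range_succ (fun i => μ.rowLen i) (M + 1),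
        Finset.sum_range_succ (fun i => ν.rowLen i) (M + 1)]
      have := h.succ M
      omega
  have h' := key N
  rw [rowLen_eq_zero (μ := μ) (i := N) (by omega)] at h'
  simpa using h'

/-- Adding a horizontal strip and then removing one can be exchanged, up to a loss of equally
many cells in both strips. -/
theorem tsum_strip_commute (k l : ℕ) (ν ρ : YoungDiagram) :
    ∑' κ, ind (IsStrip k ν κ ∧ IsStrip l ρ κ) =
      ∑' p : ℕ × YoungDiagram,
        ind ((p.1 ≤ k ∧ p.1 ≤ l) ∧ IsStrip (l - p.1) p.2 ν ∧ IsStrip (k - p.1) p.2 ρ) := by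
  refine tsum_ind_bij (Reflected ν ρ) ?_ ?_ ?_ ?_
  · rintro κ ⟨h1, h2⟩
    -- Solve the reflection rule for the smaller diagram. The subtraction does not truncate, since
    -- interlacing bounds row i + 1 of `κ` by the minimum in row i.
    obtain ⟨f, hf⟩ : ∃ f : ℕ → ℕ, ∀ i, f i = min (ν.rowLen i) (ρ.rowLen i) +
      max (ν.rowLen (i + 1)) (ρ.rowLen (i + 1)) - κ.rowLen (i + 1) := ⟨_, fun _ => rfl⟩
    have a1 := h1.le
    have a2 := h2.le
    have a3 := h1.interlace
    have a4 := h2.interlace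
    have hr : ∀ i, (ofRows f).rowLen i = f i := by
      refine rowLen_ofRows (antitone_nat_of_succ_le fun i => ?_)
        ⟨ν.colLen 0 + ρ.colLen 0, ?_⟩
      · have := hf i
        have := hf (i + 1)
        have := a1 (i + 1)
        have := a2 (i + 1)
        have := a1 (i + 1 + 1)
        have := a2 (i + 1 + 1)
        have := a3 i
        have := a4 i
        omega
      · have := hf (ν.colLen 0 + ρ.colLen 0)
        have := rowLen_eq_zero (μ := ν) (i := ν.colLen 0 + ρ.colLen 0) (by omega)
        have := rowLen_eq_zero (μ := ν) (i := ν.colLen 0 + ρ.colLen 0 + 1) (by omega)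
        have := rowLen_eq_zero (μ := ρ) (i := ν.colLen 0 + ρ.colLen 0 + 1) (by omega)
        omega
    have hR : Reflected ν ρ κ (κ.rowLen 0 - max (ν.rowLen 0) (ρ.rowLen 0), ofRows f) := by
      refine ⟨?_, fun i => ?_⟩
      · have := a1 0
        have := a2 0
        simp only
        omega
      · have := a3 i
        have := a4 i
        have := hf i
        rw [hr]
        omega
    have e : ∀ i, (ofRows f).rowLen i ≤ min (ν.rowLen i) (ρ.rowLen i) ∧
        max (ν.rowLen (i + 1)) (ρ.rowLen (i + 1)) ≤ (ofRows f).rowLen i := by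
      intro i
      have := a1 (i + 1)
      have := a2 (i + 1)
      have := a3 i
      have := a4 i
      have := hf i
      rw [hr]
      omega
    -- Together with the size identity, these two bounds say that the loss is at most l and at most
    -- k.
    have n1 : (ofRows f).card ≤ ν.card :=
      card_le_card_of_rowLen_le fun i => (e i).1.trans (min_le_left _ _)
    have n2 : (ofRows f).card ≤ ρ.card :=
      card_le_card_of_rowLen_le fun i => (e i).1.trans (min_le_right _ _)
    have c := hR.card_add_card
    have c1 := h1.card_eq
    have c2 := h2.card_eq
    refine ⟨_, ⟨⟨?_, ?_⟩, ⟨fun i => ?_, fun i => ?_, ?_⟩, fun i => ?_, fun i => ?_, ?_⟩, hR⟩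
    all_goals first
      | (have := e i; simp only at *; omega)
      | (simp only at *; omega)
  · rintro ⟨j, κ⟩ ⟨h0, h1, h2⟩
    -- The inverse reflection: row 0 has no row above to be reflected from, and the number j
    -- supplies its excess.
    obtain ⟨f, hf0, hf⟩ : ∃ f : ℕ → ℕ, f 0 = max (ν.rowLen 0) (ρ.rowLen 0) + j ∧
        ∀ i, f (i + 1) = min (ν.rowLen i) (ρ.rowLen i) +
          max (ν.rowLen (i + 1)) (ρ.rowLen (i + 1)) - κ.rowLen i :=
      ⟨fun i => Nat.rec (max (ν.rowLen 0) (ρ.rowLen 0) + j) (fun i _ =>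
        min (ν.rowLen i) (ρ.rowLen i) + max (ν.rowLen (i + 1)) (ρ.rowLen (i + 1)) -
          κ.rowLen i) i, rfl, fun _ => rfl⟩
    have a1 := h1.le
    have a2 := h2.le
    have a3 := h1.interlace
    have a4 := h2.interlace
    simp only at a1 a2 a3 a4 h0
    have hr : ∀ i, (ofRows f).rowLen i = f i := by
      refine rowLen_ofRows (antitone_nat_of_succ_le fun i => ?_)
        ⟨ν.colLen 0 + ρ.colLen 0 + 1, ?_⟩
      · have := hf i
        have := a1 i
        have := a2 i
        have := a3 i
        have := a4 i
        cases i with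
        | zero => omega
        | succ i =>
          have := hf i
          have := a1 i
          have := a2 i
          omega
      · have := hf (ν.colLen 0 + ρ.colLen 0)
        have := rowLen_eq_zero (μ := ν) (i := ν.colLen 0 + ρ.colLen 0) (by omega)
        have := rowLen_eq_zero (μ := ν) (i := ν.colLen 0 + ρ.colLen 0 + 1) (by omega)
        have := rowLen_eq_zero (μ := ρ) (i := ν.colLen 0 + ρ.colLen 0 + 1) (by omega)
        omega
    have hR : Reflected ν ρ (ofRows f) (j, κ) := by
      refine ⟨(hr 0).trans hf0, fun i => ?_⟩
      have := a1 i
      have := a2 i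
      have := hf i
      rw [hr]
      simp only
      omega
    have e : ∀ i, max (ν.rowLen i) (ρ.rowLen i) ≤ (ofRows f).rowLen i ∧
        (ofRows f).rowLen (i + 1) ≤ min (ν.rowLen i) (ρ.rowLen i) := by
      intro i
      have := a3 i
      have := a4 i
      have := hf i
      rw [hr, hr]
      cases i with
      | zero => omega
      | succ i =>
        have := hf i
        have := a1 i
        have := a2 i
        omega
    have c := hR.card_add_card
    have c1 := h1.card_eq
    have c2 := h2.card_eq
    refine ⟨_, ⟨⟨fun i => ?_, fun i => ?_, ?_⟩, fun i => ?_, fun i => ?_, ?_⟩, hR⟩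
    all_goals first
      | (have := e i; simp only at *; omega)
      | (simp only at *; omega)
  · rintro κ ⟨j, p⟩ ⟨j', p'⟩ - - h h'
    have h0 := h.zero
    have h0' := h'.zero
    have hp : p = p' := diagram_ext_rowLen fun i => by
      have := h.succ i
      have := h'.succ i
      simp only at *
      omega
    have hj : j = j' := by
      simp only at *
      omega
    rw [hp, hj]
  · rintro κ κ' p - - h h'
    refine diagram_ext_rowLen fun i => ?_
    cases i with
    | zero => rw [h.zero, h'.zero]
    | succ i =>
      have := h.succ i
      have := h'.succ i
      omega

end Strips

/-! ### Diagrams with even columns -/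

section EvenColumns

/-- All columns have even length: the rows are equal in pairs. -/
def EvenColumns (lam : YoungDiagram) : Prop := ∀ i, lam.rowLen (2 * i) = lam.rowLen (2 * i + 1)

/-- A column of odd length is one that meets row 2m but not row 2m + 1, for some m. -/
theorem isEvenPartition_transpose_iff (lam : YoungDiagram) :
    IsEvenPartition lam.transpose ↔ EvenColumns lam := by
  simp only [IsEvenPartition, YoungDiagram.rowLen_transpose]
  constructor
  · intro h i
    refine le_antisymm ?_ (rowLen_succ_le _ _)
    by_contra! hlt
    obtain ⟨m, hm⟩ := h (lam.rowLen (2 * i + 1))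
    have h1 := YoungDiagram.mem_iff_lt_colLen.1 (YoungDiagram.mem_iff_lt_rowLen.2 hlt)
    have h2 : ¬ (2 * i + 1, lam.rowLen (2 * i + 1)) ∈ lam := by
      simp [YoungDiagram.mem_iff_lt_rowLen]
    rw [YoungDiagram.mem_iff_lt_colLen] at h2
    omega
  · intro h j
    by_contra hodd
    obtain ⟨m, hm⟩ := Nat.not_even_iff_odd.1 hodd
    have h1 : (2 * m, j) ∈ lam := YoungDiagram.mem_iff_lt_colLen.2 (by omega)
    have h2 : ¬ (2 * m + 1, j) ∈ lam := by
      rw [YoungDiagram.mem_iff_lt_colLen]; omega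
    rw [YoungDiagram.mem_iff_lt_rowLen] at h1 h2
    have := h m
    omega

/-- Applied with `lam` above and `ν` below `μ`, this makes the strips `lam / μ` and `μ / ν` equally
large. -/
theorem card_add_card_of_pairs {lam μ ν : YoungDiagram}
    (h0 : ∀ i, lam.rowLen (2 * i) + lam.rowLen (2 * i + 1) = 2 * μ.rowLen (2 * i))
    (h1 : ∀ i, ν.rowLen (2 * i) + ν.rowLen (2 * i + 1) = 2 * μ.rowLen (2 * i + 1)) :
    lam.card + ν.card = 2 * μ.card := by
  set N := μ.colLen 0 + ν.colLen 0 + lam.colLen 0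
  rw [card_eq_sum_rowLen (μ := lam) (N := 2 * N) (by omega),
    card_eq_sum_rowLen (μ := μ) (N := 2 * N) (by omega),
    card_eq_sum_rowLen (μ := ν) (N := 2 * N) (by omega)]
  induction N with
  | zero => simp
  | succ N ih =>
    rw [show 2 * (N + 1) = 2 * N + 1 + 1 by ring]
    simp only [Finset.sum_range_succ]
    have := h0 N
    have := h1 N
    omega

/-- Every diagram arises in as many ways by removing a horizontal strip from a diagram with even
columns as by adding one to a diagram with even columns. -/
theorem tsum_evenColumns_strip (k : ℕ) (μ : YoungDiagram) :
    ∑' lam, ind (EvenColumns lam ∧ IsStrip k μ lam) =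
      ∑' ν, ind (EvenColumns ν ∧ IsStrip k ν μ) := by
  -- Interlacing squeezes row 2i of `μ` between two equal rows of `lam`, so `lam` is determined by
  -- `μ`; `dn` is the same for `ν` and row 2i + 1 of `μ`.
  have up : ∀ lam, EvenColumns lam → IsStrip k μ lam →
      ∀ i, lam.rowLen (2 * i) = μ.rowLen (2 * i) ∧ lam.rowLen (2 * i + 1) = μ.rowLen (2 * i) := by
    intro lam h hs i
    have := h i
    have := hs.le (2 * i)
    have := hs.interlace (2 * i)
    omega
  have dn : ∀ ν, EvenColumns ν → IsStrip k ν μ →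
      ∀ i, ν.rowLen (2 * i) = μ.rowLen (2 * i + 1) ∧
        ν.rowLen (2 * i + 1) = μ.rowLen (2 * i + 1) := by
    intro ν h hs i
    have := h i
    have := hs.le (2 * i + 1)
    have := hs.interlace (2 * i)
    omega
  have par : ∀ {P : ℕ → Prop}, (∀ i, P (2 * i)) → (∀ i, P (2 * i + 1)) → ∀ i, P i := by
    intro P h0 h1 i
    obtain ⟨m, rfl | rfl⟩ : ∃ m, i = 2 * m ∨ i = 2 * m + 1 := ⟨i / 2, by omega⟩
    · exact h0 m
    · exact h1 m
  have hanti := μ.rowLen_anti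
  -- Each side has at most one nonzero term, so the trivial relation is enough: only existence has
  -- to be carried across.
  refine tsum_ind_bij (fun _ _ => True) ?_ ?_ ?_ ?_
  · rintro lam ⟨he, hs⟩
    have hu := up lam he hs
    have hr : ∀ i, (ofRows fun i => μ.rowLen (2 * (i / 2) + 1)).rowLen i =
        μ.rowLen (2 * (i / 2) + 1) := rowLen_ofRows (fun i j hij => hanti _ _ (by omega))
      ⟨2 * μ.colLen 0, rowLen_eq_zero (by omega)⟩
    have hr0 : ∀ i, (ofRows fun i => μ.rowLen (2 * (i / 2) + 1)).rowLen (2 * i) =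
        μ.rowLen (2 * i + 1) := fun i => by rw [hr, show 2 * i / 2 = i by omega]
    have hr1 : ∀ i, (ofRows fun i => μ.rowLen (2 * (i / 2) + 1)).rowLen (2 * i + 1) =
        μ.rowLen (2 * i + 1) := fun i => by rw [hr, show (2 * i + 1) / 2 = i by omega]
    refine ⟨_, ⟨fun i => (hr0 i).trans (hr1 i).symm, ⟨?_, ?_, ?_⟩⟩, trivial⟩
    · refine par (fun i => ?_) fun i => ?_
      · rw [hr0]; exact rowLen_succ_le _ _
      · rw [hr1]
    · refine par (fun i => ?_) fun i => ?_
      · rw [hr0]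
      · rw [hr1]; exact rowLen_succ_le _ _
    · have := card_add_card_of_pairs (lam := lam) (μ := μ) (fun i => by have := hu i; omega)
        (fun i => by rw [hr0, hr1]; omega)
      have := hs.card_eq
      omega
  · rintro ν ⟨he, hs⟩
    have hd := dn ν he hs
    have hr : ∀ i, (ofRows fun i => μ.rowLen (2 * (i / 2))).rowLen i =
        μ.rowLen (2 * (i / 2)) := rowLen_ofRows (fun i j hij => hanti _ _ (by omega))
      ⟨2 * μ.colLen 0, rowLen_eq_zero (by omega)⟩
    have hr0 : ∀ i, (ofRows fun i => μ.rowLen (2 * (i / 2))).rowLen (2 * i) =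
        μ.rowLen (2 * i) := fun i => by rw [hr, show 2 * i / 2 = i by omega]
    have hr1 : ∀ i, (ofRows fun i => μ.rowLen (2 * (i / 2))).rowLen (2 * i + 1) =
        μ.rowLen (2 * i) := fun i => by rw [hr, show (2 * i + 1) / 2 = i by omega]
    refine ⟨_, ⟨fun i => (hr0 i).trans (hr1 i).symm, ⟨?_, ?_, ?_⟩⟩, trivial⟩
    · refine par (fun i => ?_) fun i => ?_
      · rw [hr0]
      · rw [hr1]; exact rowLen_succ_le _ _
    · refine par (fun i => ?_) fun i => ?_
      · rw [hr1]
      · rw [show 2 * i + 1 + 1 = 2 * (i + 1) by ring, hr0]; exact rowLen_succ_le _ _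
    · have := card_add_card_of_pairs (ν := ν) (μ := μ) (fun i => by rw [hr0, hr1]; omega)
        (fun i => by have := hd i; omega)
      have := hs.card_eq
      omega
  · rintro - ν ν' ⟨he, hs⟩ ⟨he', hs'⟩ - -
    have h1 := dn ν he hs
    have h2 := dn ν' he' hs'
    exact diagram_ext_rowLen (par (fun i => by rw [(h1 i).1, (h2 i).1])
      fun i => by rw [(h1 i).2, (h2 i).2])
  · rintro lam lam' - ⟨he, hs⟩ ⟨he', hs'⟩ - -
    have h1 := up lam he hs
    have h2 := up lam' he' hs'
    exact diagram_ext_rowLen (par (fun i => by rw [(h1 i).1, (h2 i).1])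
      fun i => by rw [(h1 i).2, (h2 i).2])

end EvenColumns

/-! ### Branching of tableaux at the largest entry -/

section Branching

theorem natCast_kostka {n : ℕ} (lam : YoungDiagram) (b : Fin n → ℕ) :
    (kostka lam b : ℝ≥0∞) = ∑' T, ind (T ∈ tableauxOfWeight lam b) :=
  natCast_ncard_eq_tsum (finite_tableauxOfWeight lam b)

theorem IsStrip.mem {k : ℕ} {μ lam : YoungDiagram} (h : IsStrip k μ lam) {c : ℕ × ℕ}
    (hc : c ∈ μ) : c ∈ lam := by
  obtain ⟨i, j⟩ := c
  rw [YoungDiagram.mem_iff_lt_rowLen] at hc ⊢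
  exact hc.trans_le (h.le i)

theorem IsStrip.mem_of_lt {k : ℕ} {μ lam : YoungDiagram} (h : IsStrip k μ lam) {i i' j : ℕ}
    (hi : i < i') (hc : (i', j) ∈ lam) : (i, j) ∈ μ := by
  have hc' : (i + 1, j) ∈ lam := lam.up_left_mem hi le_rfl hc
  rw [YoungDiagram.mem_iff_lt_rowLen] at hc' ⊢
  exact hc'.trans_le (h.interlace i)

theorem isStrip_of_mem {k : ℕ} {μ lam : YoungDiagram} (h : ∀ c, c ∈ μ → c ∈ lam)
    (h' : ∀ i j, (i + 1, j) ∈ lam → (i, j) ∈ μ) (hc : lam.card = μ.card + k) :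
    IsStrip k μ lam := by
  refine ⟨fun i => ?_, fun i => ?_, hc⟩
  · by_contra! hlt
    have := YoungDiagram.mem_iff_lt_rowLen.1 (h _ (YoungDiagram.mem_iff_lt_rowLen.2 hlt))
    omega
  · by_contra! hlt
    have := YoungDiagram.mem_iff_lt_rowLen.1 (h' _ _ (YoungDiagram.mem_iff_lt_rowLen.2 hlt))
    omega

/-- The tableau of shape `μ` is the restriction of the tableau of shape `lam` to its entries that
are at most `n`. -/
def IsRestriction (n : ℕ) {lam : YoungDiagram} (T : SemistandardYoungTableau lam)
    (p : Σ μ : YoungDiagram, SemistandardYoungTableau μ) : Prop :=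
  (∀ i j, (i, j) ∈ p.1 ↔ (i, j) ∈ lam ∧ T i j ≤ n) ∧ ∀ i j, (i, j) ∈ p.1 → p.2 i j = T i j

theorem card_filter_restriction {n : ℕ} {lam : YoungDiagram} {T : SemistandardYoungTableau lam}
    {p : Σ μ : YoungDiagram, SemistandardYoungTableau μ} (h : IsRestriction n T p) (k : ℕ)
    (hk : k ≤ n) :
    (p.1.cells.filter fun c => p.2 c.1 c.2 = k).card =
      (lam.cells.filter fun c => T c.1 c.2 = k).card := by
  congr 1
  ext ⟨i, j⟩
  simp only [Finset.mem_filter, YoungDiagram.mem_cells]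
  constructor
  · rintro ⟨h1, h2⟩
    exact ⟨((h.1 i j).1 h1).1, (h.2 i j h1).symm.trans h2⟩
  · rintro ⟨h1, h2⟩
    have h3 : (i, j) ∈ p.1 := (h.1 i j).2 ⟨h1, by omega⟩
    exact ⟨h3, (h.2 i j h3).trans h2⟩

theorem card_eq_of_restriction {n : ℕ} {lam : YoungDiagram} {T : SemistandardYoungTableau lam}
    {p : Σ μ : YoungDiagram, SemistandardYoungTableau μ} (h : IsRestriction n T p)
    (hT : ∀ c ∈ lam.cells, T c.1 c.2 ≤ n + 1) :
    lam.card = p.1.card + (lam.cells.filter fun c => T c.1 c.2 = n + 1).card := by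
  rw [YoungDiagram.card, ← Finset.card_filter_add_card_filter_not (fun c => T c.1 c.2 ≤ n)]
  congr 2
  · ext ⟨i, j⟩
    simp only [Finset.mem_filter, YoungDiagram.mem_cells]
    exact (h.1 i j).symm
  · ext ⟨i, j⟩
    simp only [Finset.mem_filter]
    refine and_congr_right fun hc => ?_
    have := hT _ hc
    simp only at this
    omega

theorem exists_restriction (n : ℕ) {lam : YoungDiagram} (T : SemistandardYoungTableau lam) :
    ∃ p, IsRestriction n T p := by
  classical
  let μ : YoungDiagram :=
    { cells := lam.cells.filter fun c => T c.1 c.2 ≤ n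
      isLowerSet := by
        rintro ⟨i, j⟩ ⟨i', j'⟩ ⟨h1, h2⟩ hc
        simp only [Finset.coe_filter, Set.mem_ofPred_eq, YoungDiagram.mem_cells] at hc h1 h2 ⊢
        refine ⟨lam.up_left_mem h1 h2 hc.1, ?_⟩
        exact ((T.col_weak h1 (lam.up_left_mem le_rfl h2 hc.1)).trans
          (T.row_weak_of_le h2 hc.1)).trans hc.2 }
  have hμ : ∀ i j, (i, j) ∈ μ ↔ (i, j) ∈ lam ∧ T i j ≤ n := by
    intro i j
    rw [← YoungDiagram.mem_cells]
    simp [μ]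
  refine ⟨⟨μ, ⟨fun i j => if (i, j) ∈ μ then T i j else 0, ?_, ?_, fun h => if_neg h⟩⟩, hμ,
    fun i j h => if_pos h⟩
  · intro i j j' hj hc
    rw [if_pos hc, if_pos (μ.up_left_mem le_rfl hj.le hc)]
    exact T.row_weak hj ((hμ _ _).1 hc).1
  · intro i i' j hi hc
    rw [if_pos hc, if_pos (μ.up_left_mem hi.le le_rfl hc)]
    exact T.col_strict hi ((hμ _ _).1 hc).1

theorem exists_extension {n k : ℕ} {μ lam : YoungDiagram} (h : IsStrip k μ lam)
    (T : SemistandardYoungTableau μ) (hT : ∀ c ∈ μ.cells, T c.1 c.2 ≤ n) :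
    ∃ T' : SemistandardYoungTableau lam, IsRestriction n T' ⟨μ, T⟩ ∧
      ∀ i j, (i, j) ∈ lam → (i, j) ∉ μ → T' i j = n + 1 := by
  classical
  refine ⟨⟨fun i j => if (i, j) ∈ μ then T i j else if (i, j) ∈ lam then n + 1 else 0, ?_, ?_,
    ?_⟩, ⟨?_, ?_⟩, ?_⟩
  · intro i j j' hj hc
    by_cases hc' : (i, j') ∈ μ
    · rw [if_pos hc', if_pos (μ.up_left_mem le_rfl hj.le hc')]
      exact T.row_weak hj hc'
    · rw [if_neg hc', if_pos hc]
      split_ifs with h1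
      · exact (hT _ h1).trans (Nat.le_succ n)
      · exact le_rfl
      · exact Nat.zero_le _
  · intro i i' j hi hc
    -- A cell of `lam` with another one below it lies in `μ`, so two entries n + 1 never share a
    -- column.
    have h1 := h.mem_of_lt hi hc
    rw [if_pos h1]
    split_ifs with h2
    · exact T.col_strict hi h2
    · exact Nat.lt_succ_of_le (hT _ h1)
  · intro i j hc
    rw [if_neg fun h' => hc (h.mem h'), if_neg hc]
  · intro i j
    change _ ↔ _ ∧ (if (i, j) ∈ μ then T i j else if (i, j) ∈ lam then n + 1 else 0) ≤ n
    by_cases h1 : (i, j) ∈ μ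
    · simpa [h1, h.mem h1] using hT _ h1
    · by_cases h2 : (i, j) ∈ lam <;> simp [h1, h2]
  · intro i j h1
    exact (if_pos h1).symm
  · intro i j h1 h2
    exact (if_neg h2).trans (if_pos h1)

theorem mem_tableauxOfWeight_iff_restriction {n : ℕ} {lam : YoungDiagram}
    {T : SemistandardYoungTableau lam} {p : Σ μ : YoungDiagram, SemistandardYoungTableau μ}
    (h : IsRestriction n T p) (hT : ∀ c ∈ lam.cells, T c.1 c.2 ≤ n + 1) (b : Fin (n + 1) → ℕ) :
    T ∈ tableauxOfWeight lam b ↔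
      lam.card = p.1.card + b (Fin.last n) ∧ p.2 ∈ tableauxOfWeight p.1 (Fin.init b) := by
  have hcard := card_eq_of_restriction h hT
  constructor
  · rintro ⟨h1, h2⟩
    refine ⟨by simpa using h2 (Fin.last n) ▸ hcard, ?_, fun k => ?_⟩
    · rintro ⟨i, j⟩ hc
      have hc' := (h.1 i j).1 hc
      simp only
      rw [h.2 i j hc]
      exact ⟨(h1 _ hc'.1).1, hc'.2⟩
    · rw [card_filter_restriction h _ (by omega)]
      exact h2 k.castSucc
  · rintro ⟨h1, h2, h3⟩
    refine ⟨?_, fun k => ?_⟩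
    · rintro ⟨i, j⟩ hc
      refine ⟨?_, hT _ hc⟩
      by_cases hn : T i j ≤ n
      · have hp := (h.1 i j).2 ⟨hc, hn⟩
        have := (h2 _ hp).1
        rwa [h.2 i j hp] at this
      · simp only
        omega
    · refine Fin.lastCases ?_ (fun k => ?_) k
      · simp only [Fin.val_last]
        omega
      · have := h3 k
        rw [card_filter_restriction h _ (by omega)] at this
        exact this

/-- An entry with another below it is strictly smaller than that one, hence at most n, and so it
survives the restriction. -/
theorem isStrip_of_restriction {n k : ℕ} {lam : YoungDiagram} {T : SemistandardYoungTableau lam}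
    {p : Σ μ : YoungDiagram, SemistandardYoungTableau μ}
    (h : IsRestriction n T p) (hT : ∀ c ∈ lam.cells, T c.1 c.2 ≤ n + 1)
    (hc : lam.card = p.1.card + k) : IsStrip k p.1 lam := by
  refine isStrip_of_mem (fun c hc => ((h.1 c.1 c.2).1 hc).1) (fun i j hm => ?_) hc
  refine (h.1 i j).2 ⟨lam.up_left_mem (Nat.le_succ i) le_rfl hm, ?_⟩
  have h1 := T.col_strict (i1 := i) (i2 := i + 1) (Nat.lt_succ_self i) hm
  have h2 := hT _ hm
  simp only at h2
  omega

/-- The branching rule for Kostka numbers: remove the largest entries. -/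
theorem kostka_branching {n : ℕ} (lam : YoungDiagram) (b : Fin (n + 1) → ℕ) :
    (kostka lam b : ℝ≥0∞) =
      ∑' μ, ind (IsStrip (b (Fin.last n)) μ lam) * kostka μ (Fin.init b) := by
  have hR : ∀ μ, ind (IsStrip (b (Fin.last n)) μ lam) * (kostka μ (Fin.init b) : ℝ≥0∞) =
      ∑' T, ind (IsStrip (b (Fin.last n)) μ lam ∧ T ∈ tableauxOfWeight μ (Fin.init b)) := by
    intro μ
    simp only [ind_and]
    rw [ENNReal.tsum_mul_left, natCast_kostka]
  simp only [hR]
  rw [natCast_kostka, ← ENNReal.tsum_sigma' fun p : Σ μ : YoungDiagram,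
    SemistandardYoungTableau μ =>
      ind (IsStrip (b (Fin.last n)) p.1 lam ∧ p.2 ∈ tableauxOfWeight p.1 (Fin.init b))]
  -- The bound makes `T` recoverable from `p`: every lost cell must hold n + 1.
  refine tsum_ind_bij (fun T p => IsRestriction n T p ∧ ∀ c ∈ lam.cells, T c.1 c.2 ≤ n + 1)
    ?_ ?_ ?_ ?_
  · intro T hT
    obtain ⟨p, hp⟩ := exists_restriction n T
    have hT' : ∀ c ∈ lam.cells, T c.1 c.2 ≤ n + 1 := fun c hc => (hT.1 c hc).2
    have := (mem_tableauxOfWeight_iff_restriction hp hT' b).1 hT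
    exact ⟨p, ⟨isStrip_of_restriction hp hT' this.1, this.2⟩, hp, hT'⟩
  · rintro ⟨μ, T⟩ ⟨hs, hT⟩
    obtain ⟨T', hT', h⟩ := exists_extension (n := n) hs T fun c hc => (hT.1 c hc).2
    have hle : ∀ c ∈ lam.cells, T' c.1 c.2 ≤ n + 1 := by
      rintro ⟨i, j⟩ hc
      by_cases hm : (i, j) ∈ μ
      · exact ((hT'.1 i j).1 hm).2.trans (Nat.le_succ n)
      · exact (h i j hc hm).le
    exact ⟨T', (mem_tableauxOfWeight_iff_restriction hT' hle b).2 ⟨hs.card_eq, hT⟩, hT', hle⟩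
  · rintro T ⟨μ, S⟩ ⟨μ', S'⟩ - - ⟨h, -⟩ ⟨h', -⟩
    have hμ : μ = μ' := by
      apply YoungDiagram.ext
      ext ⟨i, j⟩
      exact (h.1 i j).trans (h'.1 i j).symm
    subst hμ
    congr 1
    refine SemistandardYoungTableau.ext fun i j => ?_
    by_cases hc : (i, j) ∈ μ
    · exact (h.2 i j hc).trans (h'.2 i j hc).symm
    · rw [S.zeros hc, S'.zeros hc]
  · rintro T T' ⟨μ, S⟩ - - ⟨h, hT⟩ ⟨h', hT'⟩
    refine SemistandardYoungTableau.ext fun i j => ?_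
    by_cases hc : (i, j) ∈ μ
    · exact (h.2 i j hc).symm.trans (h'.2 i j hc)
    · by_cases hl : (i, j) ∈ lam
      · have h1 : ¬T i j ≤ n := fun h0 => hc ((h.1 i j).2 ⟨hl, h0⟩)
        have h2 : ¬T' i j ≤ n := fun h0 => hc ((h'.1 i j).2 ⟨hl, h0⟩)
        have h3 := hT _ hl
        have h4 := hT' _ hl
        simp only at h3 h4
        omega
      · rw [T.zeros hl, T'.zeros hl]

theorem kostka_zero (lam : YoungDiagram) (b : Fin 0 → ℕ) :
    (kostka lam b : ℝ≥0∞) = ind (lam = ⊥) := by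
  by_cases h : lam = ⊥
  · subst h
    rw [ind_of_true rfl, kostka, Nat.cast_eq_one, Set.ncard_eq_one]
    refine ⟨default, Set.eq_singleton_iff_unique_mem.2 ⟨⟨by simp, fun k => k.elim0⟩, ?_⟩⟩
    intro T _
    refine SemistandardYoungTableau.ext fun i j => ?_
    rw [T.zeros (YoungDiagram.notMem_bot _), SemistandardYoungTableau.zeros _
      (YoungDiagram.notMem_bot _)]
  · rw [ind_of_false h, kostka, Nat.cast_eq_zero, Set.ncard_eq_zero (finite_tableauxOfWeight _ _),
      Set.eq_empty_iff_forall_notMem]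
    rintro T ⟨hT, -⟩
    apply h
    apply YoungDiagram.ext
    rw [YoungDiagram.cells_bot, Finset.eq_empty_iff_forall_notMem]
    intro c hc
    have := hT c hc
    omega

end Branching

/-! ### The Pieri rule on weights -/

section Pieri

/-- The sum of `g` over the vectors obtained from `b` by a decrease of total size `k`. -/
noncomputable def decreaseSum {n : ℕ} (k : ℕ) (b : Fin n → ℕ) (g : (Fin n → ℕ) → ℝ≥0∞) : ℝ≥0∞ :=
  ∑' c : Fin n → ℕ, ind (c ≤ b ∧ ∑ i, c i = k) * g (b - c)

theorem tsum_decreaseSum {α : Type*} {n : ℕ} (k : ℕ) (b : Fin n → ℕ)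
    (g : α → (Fin n → ℕ) → ℝ≥0∞) :
    ∑' a, decreaseSum k b (g a) = decreaseSum k b fun d => ∑' a, g a d := by
  simp only [decreaseSum]
  rw [ENNReal.tsum_comm]
  simp only [ENNReal.tsum_mul_left]

theorem mul_decreaseSum {n : ℕ} (k : ℕ) (b : Fin n → ℕ) (x : ℝ≥0∞) (g : (Fin n → ℕ) → ℝ≥0∞) :
    x * decreaseSum k b g = decreaseSum k b fun d => x * g d := by
  simp only [decreaseSum]
  rw [← ENNReal.tsum_mul_left]
  exact tsum_congr fun c => mul_left_comm _ _ _

/-- The last coordinate j of the decrease is split off; it will match the loss j in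
`tsum_strip_commute`. -/
theorem decreaseSum_succ {n : ℕ} (k : ℕ) (b : Fin (n + 1) → ℕ) (g : (Fin (n + 1) → ℕ) → ℝ≥0∞) :
    decreaseSum k b g = ∑' j, ind (j ≤ k ∧ j ≤ b (Fin.last n)) *
      decreaseSum (k - j) (Fin.init b)
        fun d => g (Fin.snoc (α := fun _ => ℕ) d (b (Fin.last n) - j)) := by
  simp only [decreaseSum]
  rw [← (Fin.snocEquiv fun _ => ℕ).tsum_eq, ENNReal.tsum_prod']
  refine tsum_congr fun j => ?_
  rw [← ENNReal.tsum_mul_left]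
  refine tsum_congr fun c => ?_
  simp only [Fin.snocEquiv, Equiv.coe_fn_mk]
  rw [← mul_assoc, ← ind_and]
  have h1 : ((Fin.snoc (α := fun _ => ℕ) c j : Fin (n + 1) → ℕ) ≤ b ∧
      ∑ i, (Fin.snoc (α := fun _ => ℕ) c j : Fin (n + 1) → ℕ) i = k) ↔
      (j ≤ k ∧ j ≤ b (Fin.last n)) ∧ c ≤ Fin.init b ∧ ∑ i, c i = k - j := by
    rw [Fin.sum_univ_castSucc]
    simp only [Fin.snoc_castSucc, Fin.snoc_last, Pi.le_def, Fin.forall_fin_succ', Fin.init]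
    constructor
    · rintro ⟨⟨h1, h2⟩, h3⟩
      exact ⟨⟨by omega, h2⟩, h1, by omega⟩
    · rintro ⟨⟨h1, h2⟩, h3, h4⟩
      exact ⟨⟨h3, h2⟩, by omega⟩
  rw [ind_congr h1]
  congr 2
  funext i
  refine Fin.lastCases ?_ (fun i => ?_) i
  · simp
  · simp [Fin.init]

theorem rowLen_bot (i : ℕ) : (⊥ : YoungDiagram).rowLen i = 0 := by
  by_contra h
  exact YoungDiagram.notMem_bot _ (YoungDiagram.mem_iff_lt_rowLen.2 (Nat.pos_of_ne_zero h))

theorem isStrip_bot_right {k : ℕ} {ν : YoungDiagram} :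
    IsStrip k ν ⊥ ↔ ν = ⊥ ∧ k = 0 := by
  constructor
  · intro h
    have hν : ν = ⊥ := diagram_ext_rowLen fun i => by
      have := h.le i
      rw [rowLen_bot] at this ⊢
      omega
    subst hν
    exact ⟨rfl, by simpa using h.card_eq⟩
  · rintro ⟨rfl, rfl⟩
    exact ⟨fun _ => le_rfl, fun i => by simp [rowLen_bot], rfl⟩

/-- The Pieri rule for the complete homogeneous symmetric polynomials, coefficientwise. -/
theorem tsum_strip_mul_kostka {n : ℕ} (k : ℕ) (ν : YoungDiagram) (b : Fin n → ℕ) :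
    ∑' μ, ind (IsStrip k ν μ) * (kostka μ b : ℝ≥0∞) =
      decreaseSum k b fun d => (kostka ν d : ℝ≥0∞) := by
  induction n generalizing k ν with
  | zero =>
    simp only [kostka_zero, decreaseSum]
    rw [tsum_eq_single ⊥ fun μ hμ => by rw [ind_of_false hμ, mul_zero],
      tsum_eq_single 0 fun c hc => absurd (Subsingleton.elim _ _) hc, ind_of_true rfl, mul_one,
      ← ind_and]
    refine ind_congr ?_
    rw [isStrip_bot_right]
    simp [Subsingleton.elim (0 : Fin 0 → ℕ) b, and_comm, eq_comm]
  | succ n ih =>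
    -- Branching turns the sum into adding a k-strip and removing an l-strip. After the exchange
    -- with loss j, the induction hypothesis absorbs the added (k - j)-strip, and the removed (l -
    -- j)-strip is a branching of `ν` whose last weight is l - j.
    set l := b (Fin.last n) with hl
    calc ∑' μ, ind (IsStrip k ν μ) * (kostka μ b : ℝ≥0∞)
        = ∑' μ, ∑' ρ, ind (IsStrip k ν μ ∧ IsStrip l ρ μ) * kostka ρ (Fin.init b) := by
          refine tsum_congr fun μ => ?_
          rw [kostka_branching, ← ENNReal.tsum_mul_left]
          exact tsum_congr fun ρ => by rw [ind_and, mul_assoc]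
      _ = ∑' ρ, (∑' μ, ind (IsStrip k ν μ ∧ IsStrip l ρ μ)) * kostka ρ (Fin.init b) := by
          rw [ENNReal.tsum_comm]
          simp only [ENNReal.tsum_mul_right]
      _ = ∑' ρ, ∑' p : ℕ × YoungDiagram, (ind (p.1 ≤ k ∧ p.1 ≤ l) * ind (IsStrip (l - p.1) p.2 ν))
            * (ind (IsStrip (k - p.1) p.2 ρ) * kostka ρ (Fin.init b)) := by
          refine tsum_congr fun ρ => ?_
          rw [tsum_strip_commute, ← ENNReal.tsum_mul_right]
          exact tsum_congr fun p => by
            rw [ind_and (_ ∧ _) (_ ∧ _), ind_and (IsStrip _ _ _)]; ring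
      _ = ∑' p : ℕ × YoungDiagram, (ind (p.1 ≤ k ∧ p.1 ≤ l) * ind (IsStrip (l - p.1) p.2 ν)) *
            decreaseSum (k - p.1) (Fin.init b) fun d => (kostka p.2 d : ℝ≥0∞) := by
          rw [ENNReal.tsum_comm]
          refine tsum_congr fun p => ?_
          rw [ENNReal.tsum_mul_left, ih]
      _ = ∑' j, ind (j ≤ k ∧ j ≤ l) * decreaseSum (k - j) (Fin.init b)
            fun d => ∑' κ, ind (IsStrip (l - j) κ ν) * (kostka κ d : ℝ≥0∞) := by
          rw [ENNReal.tsum_prod']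
          refine tsum_congr fun j => ?_
          simp only [mul_assoc]
          rw [ENNReal.tsum_mul_left]
          congr 1
          simp only [mul_decreaseSum]
          rw [tsum_decreaseSum]
      _ = _ := by
          rw [decreaseSum_succ]
          refine tsum_congr fun j => ?_
          simp only [kostka_branching ν (Fin.snoc (α := fun _ => ℕ) _ _), Fin.snoc_last,
            Fin.init_snoc]
          rfl

end Pieri

/-! ### The sum over even-column shapes -/

section Littlewood

/-- The recursion that deletes the last entry of the weight, for the sum of the Kostka numbers of
the shapes with even columns. -/
theorem tsum_evenColumns_kostka_succ {n : ℕ} (b : Fin (n + 1) → ℕ) :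
    ∑' lam, ind (EvenColumns lam) * (kostka lam b : ℝ≥0∞) =
      decreaseSum (b (Fin.last n)) (Fin.init b)
        fun d => ∑' ν, ind (EvenColumns ν) * (kostka ν d : ℝ≥0∞) := by
  set l := b (Fin.last n) with hl
  calc ∑' lam, ind (EvenColumns lam) * (kostka lam b : ℝ≥0∞)
      = ∑' lam, ∑' μ, ind (EvenColumns lam ∧ IsStrip l μ lam) * kostka μ (Fin.init b) := by
        refine tsum_congr fun lam => ?_
        rw [kostka_branching, ← ENNReal.tsum_mul_left]
        exact tsum_congr fun μ => by rw [ind_and, mul_assoc]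
    _ = ∑' μ, ∑' ν, ind (EvenColumns ν ∧ IsStrip l ν μ) * kostka μ (Fin.init b) := by
        rw [ENNReal.tsum_comm]
        simp only [ENNReal.tsum_mul_right, tsum_evenColumns_strip]
    _ = ∑' ν, ind (EvenColumns ν) * ∑' μ, ind (IsStrip l ν μ) * kostka μ (Fin.init b) := by
        rw [ENNReal.tsum_comm]
        simp only [ind_and, mul_assoc, ENNReal.tsum_mul_left]
    _ = _ := by
        simp only [tsum_strip_mul_kostka, mul_decreaseSum]
        rw [tsum_decreaseSum]

theorem tsum_evenColumns_kostka_zero (b : Fin 0 → ℕ) :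
    ∑' lam, ind (EvenColumns lam) * (kostka lam b : ℝ≥0∞) = 1 := by
  simp only [kostka_zero]
  rw [tsum_eq_single ⊥ fun μ hμ => by rw [ind_of_false hμ, mul_zero], ind_of_true rfl, mul_one,
    ind_of_true (show EvenColumns ⊥ from fun i => by rw [rowLen_bot, rowLen_bot])]

theorem card_eq_of_mem_tableauxOfWeight {n : ℕ} {lam : YoungDiagram} {b : Fin n → ℕ}
    {T : SemistandardYoungTableau lam} (hT : T ∈ tableauxOfWeight lam b) :
    lam.card = ∑ i, b i := by
  have hm : ∀ c ∈ lam.cells, T c.1 c.2 - 1 ∈ Finset.range n := fun c hc => by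
    have := hT.1 c hc
    exact Finset.mem_range.2 (by omega)
  rw [YoungDiagram.card, Finset.card_eq_sum_card_fiberwise hm, Finset.sum_range]
  refine Finset.sum_congr rfl fun k _ => ?_
  rw [← hT.2 k]
  congr 1
  refine Finset.filter_congr fun c hc => ?_
  have := hT.1 c hc
  omega

/-- The size condition on the shape may be dropped, because a shape with a number of cells other
than |b| has no tableau of weight b. -/
theorem natCast_sum_evenConjugatePartitions {n : ℕ} (b : Fin n → ℕ) :
    ((∑ μ ∈ evenConjugatePartitions (∑ i, b i), kostka μ b : ℕ) : ℝ≥0∞) =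
      ∑' lam, ind (EvenColumns lam) * (kostka lam b : ℝ≥0∞) := by
  have hmem : ∀ lam, lam ∈ evenConjugatePartitions (∑ i, b i) ↔
      lam.card = ∑ i, b i ∧ EvenColumns lam := by
    intro lam
    rw [← isEvenPartition_transpose_iff]
    simp [evenConjugatePartitions, partitionsOf]
  rw [tsum_eq_sum (s := evenConjugatePartitions (∑ i, b i)), Nat.cast_sum]
  · refine Finset.sum_congr rfl fun lam h => ?_
    rw [ind_of_true ((hmem lam).1 h).2, one_mul]
  · intro lam h
    by_cases he : EvenColumns lam
    · have : kostka lam b = 0 := by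
        rw [kostka, Set.ncard_eq_zero (finite_tableauxOfWeight _ _),
          Set.eq_empty_iff_forall_notMem]
        intro T hT
        exact h ((hmem lam).2 ⟨card_eq_of_mem_tableauxOfWeight hT, he⟩)
      rw [this, Nat.cast_zero, mul_zero]
    · rw [ind_of_false he, zero_mul]

end Littlewood

/-! ### Monomial bases of the graded pieces -/

section HilbertFunction

theorem weight_eq_mulVec {m σ : Type*} [Fintype σ] (B : Matrix m σ ℤ) (d : σ →₀ ℕ) :
    Finsupp.weight (fun e k => B k e) d = B.mulVec fun e => (d e : ℤ) := by
  have h : Finsupp.weight (fun e k => B k e) d = ∑ e, d e • fun k => B k e := by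
    rw [Finsupp.weight_apply]
    exact Finsupp.sum_fintype _ _ fun _ => zero_smul ℕ _
  rw [h]
  funext k
  refine (Finset.sum_apply k _ _).trans (Finset.sum_congr rfl fun e _ => ?_)
  simp [mul_comm]

/-- The exponents of the monomials of given degree are the partition vectors. -/
noncomputable def exponentsEquivPartitionVectors {m σ : Type*} [Fintype σ] (B : Matrix m σ ℤ) (a : m → ℤ) :
    {d : σ →₀ ℕ | Finsupp.weight (fun e k => B k e) d = a} ≃ partitionVectors B a :=
  Finsupp.equivFunOnFinite.subtypeEquiv fun d => by
    simp only [Set.mem_ofPred_eq, partitionVectors, weight_eq_mulVec]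
    rfl

/-- The monomials of degree `a` form a basis of the homogeneous component. -/
noncomputable def gradedPieceBasis (K : Type*) [Field K] {m σ : Type*} [Fintype σ]
    (B : Matrix m σ ℤ) (a : m → ℤ) : Module.Basis (partitionVectors B a) K (gradedPiece K B a) :=
  ((MvPolynomial.basisRestrictSupport K
    {d : σ →₀ ℕ | Finsupp.weight (fun e k => B k e) d = a}).map
    (LinearEquiv.ofEq _ _ (MvPolynomial.weightedHomogeneousSubmodule_eq_finsupp_supported K
      (fun e k => B k e) a).symm)).reindex (exponentsEquivPartitionVectors B a)

/-- No finiteness is needed here: for an infinite basis, both `Module.finrank` and `Set.ncard` take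
the value 0. -/
theorem hilbertFunction_eq_vectorPartitionFunction (K : Type*) [Field K] {m σ : Type*}
    [Fintype σ] (B : Matrix m σ ℤ) (a : m → ℤ) :
    hilbertFunction K B a = vectorPartitionFunction B a :=
  Module.finrank_eq_nat_card_basis (gradedPieceBasis K B a)

theorem finite_gradedPiece (K : Type*) [Field K] {m σ : Type*} [Fintype σ] {B : Matrix m σ ℤ}
    {a : m → ℤ} (h : (partitionVectors B a).Finite) : Module.Finite K (gradedPiece K B a) := by
  have := h.to_subtype
  exact Module.Finite.of_basis (gradedPieceBasis K B a)

end HilbertFunction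

/-! ### Multigraphs and matchings on the complete graph -/

section CompleteGraph

/-- The sum of the multiplicities of the pairs that contain a given vertex. -/
def pairDegree {n : ℕ} (x : PairIndex n → ℕ) (k : Fin n) : ℕ :=
  ∑ p : PairIndex n, if k = p.1.1 ∨ k = p.1.2 then x p else 0

theorem mem_partitionVectors_matrixA {n : ℕ} {x : PairIndex n → ℕ} {b : Fin n → ℕ} :
    x ∈ partitionVectors (matrixA n) (fun i => (b i : ℤ)) ↔ ∀ k, pairDegree x k = b k := by
  rw [partitionVectors, Set.mem_ofPred_eq, funext_iff]
  refine forall_congr' fun k => ?_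
  rw [← Nat.cast_inj (R := ℤ), pairDegree]
  simp [Matrix.mulVec, dotProduct, matrixA]

theorem finite_partitionVectors_matrixA {n : ℕ} (b : Fin n → ℕ) :
    (partitionVectors (matrixA n) (fun i => (b i : ℤ))).Finite := by
  -- Each multiplicity is at most the degree of the first endpoint of its pair.
  refine (Set.finite_Iic fun p : PairIndex n => b p.1.1).subset fun x hx p => ?_
  simp only
  rw [← mem_partitionVectors_matrixA.1 hx, pairDegree]
  refine le_trans ?_ (Finset.single_le_sum (fun _ _ => Nat.zero_le _) (Finset.mem_univ p))
  simp

/-- The pairs in `Fin (n + 1)` are those in `Fin n` and those that contain the last vertex. -/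
noncomputable def pairIndexSuccEquiv (n : ℕ) : PairIndex n ⊕ Fin n ≃ PairIndex (n + 1) :=
  Equiv.ofBijective
    (Sum.elim (fun p => ⟨(p.1.1.castSucc, p.1.2.castSucc), Fin.castSucc_lt_castSucc_iff.2 p.2⟩)
      fun i => ⟨(i.castSucc, Fin.last n), Fin.castSucc_lt_last i⟩) (by
    constructor
    · rintro (⟨⟨i, j⟩, h⟩ | i) (⟨⟨i', j'⟩, h'⟩ | i') hh
      · simpa using hh
      · simp [Fin.ext_iff] at hh
        omega
      · simp [Fin.ext_iff] at hh
        omega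
      · simpa using hh
    · rintro ⟨⟨i, j⟩, h⟩
      obtain ⟨i, rfl⟩ := Fin.exists_castSucc_eq.2 (Fin.ne_last_of_lt h)
      induction j using Fin.lastCases with
      | last => exact ⟨Sum.inr i, rfl⟩
      | cast j => exact ⟨Sum.inl ⟨(i, j), h⟩, rfl⟩)

theorem pairIndexSuccEquiv_inl {n : ℕ} (p : PairIndex n) :
    (pairIndexSuccEquiv n (Sum.inl p)).1 = (p.1.1.castSucc, p.1.2.castSucc) := rfl

theorem pairIndexSuccEquiv_inr {n : ℕ} (i : Fin n) :
    (pairIndexSuccEquiv n (Sum.inr i)).1 = (i.castSucc, Fin.last n) := rfl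

theorem pairDegree_succ_castSucc {n : ℕ} (x : PairIndex (n + 1) → ℕ) (k : Fin n) :
    pairDegree x k.castSucc = pairDegree (fun p => x (pairIndexSuccEquiv n (Sum.inl p))) k +
      x (pairIndexSuccEquiv n (Sum.inr k)) := by
  rw [pairDegree, ← (pairIndexSuccEquiv n).sum_comp, Fintype.sum_sum_type]
  congr 1
  · exact Finset.sum_congr rfl fun p _ => by simp [pairIndexSuccEquiv_inl]
  · simp [pairIndexSuccEquiv_inr, (Fin.castSucc_lt_last k).ne]

theorem pairDegree_succ_last {n : ℕ} (x : PairIndex (n + 1) → ℕ) :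
    pairDegree x (Fin.last n) = ∑ k, x (pairIndexSuccEquiv n (Sum.inr k)) := by
  rw [pairDegree, ← (pairIndexSuccEquiv n).sum_comp, Fintype.sum_sum_type]
  simp [pairIndexSuccEquiv_inl, pairIndexSuccEquiv_inr, (Fin.castSucc_lt_last _).ne']

/-- The recursion that deletes the last vertex, for the number of multigraphs with given
degrees. -/
theorem tsum_pairDegree_succ {n : ℕ} (b : Fin (n + 1) → ℕ) :
    ∑' x : PairIndex (n + 1) → ℕ, ind (∀ k, pairDegree x k = b k) =
      decreaseSum (b (Fin.last n)) (Fin.init b)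
        fun d => ∑' y : PairIndex n → ℕ, ind (∀ k, pairDegree y k = d k) := by
  simp only [decreaseSum, ← ENNReal.tsum_mul_left]
  rw [ENNReal.tsum_comm, ← ENNReal.tsum_prod' (f := fun q : (PairIndex n → ℕ) × (Fin n → ℕ) =>
      ind (q.2 ≤ Fin.init b ∧ ∑ i, q.2 i = b (Fin.last n)) *
        ind (∀ k, pairDegree q.1 k = (Fin.init b - q.2) k)),
    ← (((Equiv.sumArrowEquivProdArrow (PairIndex n) (Fin n) ℕ).symm.trans
      ((pairIndexSuccEquiv n).arrowCongr (Equiv.refl ℕ)))).tsum_eq]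
  -- `y` is the multigraph on the remaining vertices, and `c` lists the multiplicities of the edges
  -- to the deleted vertex.
  refine tsum_congr fun ⟨y, c⟩ => ?_
  rw [← ind_and]
  refine ind_congr ?_
  rw [Fin.forall_fin_succ']
  simp only [pairDegree_succ_castSucc, pairDegree_succ_last, Equiv.trans_apply,
    Equiv.arrowCongr_apply, Function.comp_apply, Equiv.symm_apply_apply, Equiv.refl_apply,
    Equiv.sumArrowEquivProdArrow_symm_apply_inl, Equiv.sumArrowEquivProdArrow_symm_apply_inr,
    Pi.sub_apply, Pi.le_def, Fin.init]
  change ((∀ k, pairDegree y k + c k = b k.castSucc) ∧ ∑ k, c k = b (Fin.last n)) ↔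
    ((∀ k, c k ≤ b k.castSucc) ∧ ∑ k, c k = b (Fin.last n)) ∧
      ∀ k, pairDegree y k = b k.castSucc - c k
  constructor
  · rintro ⟨h1, h2⟩
    exact ⟨⟨fun k => by have := h1 k; omega, h2⟩, fun k => by have := h1 k; omega⟩
  · rintro ⟨⟨h1, h2⟩, h3⟩
    exact ⟨fun k => by have := h1 k; have := h3 k; omega, h2⟩

/-- Both sides satisfy the same recursion in n and equal 1 for n = 0, where the empty multigraph
faces the empty diagram. -/
theorem tsum_pairDegree_eq_tsum_evenColumns {n : ℕ} (b : Fin n → ℕ) :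
    ∑' x : PairIndex n → ℕ, ind (∀ k, pairDegree x k = b k) =
      ∑' lam, ind (EvenColumns lam) * (kostka lam b : ℝ≥0∞) := by
  induction n with
  | zero =>
    have : IsEmpty (PairIndex 0) := ⟨fun p => p.1.1.elim0⟩
    rw [tsum_evenColumns_kostka_zero,
      tsum_eq_single 0 fun c hc => absurd (Subsingleton.elim _ _) hc,
      ind_of_true fun k => k.elim0]
  | succ n ih =>
    rw [tsum_evenColumns_kostka_succ, tsum_pairDegree_succ]
    simp only [ih]

theorem vectorPartitionFunction_matrixA_eq_sum_kostka {n : ℕ} (b : Fin n → ℕ) :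
    vectorPartitionFunction (matrixA n) (fun i => (b i : ℤ)) =
      ∑ μ ∈ evenConjugatePartitions (∑ i, b i), kostka μ b := by
  rw [← Nat.cast_inj (R := ℝ≥0∞), natCast_sum_evenConjugatePartitions,
    ← tsum_pairDegree_eq_tsum_evenColumns, vectorPartitionFunction,
    natCast_ncard_eq_tsum (finite_partitionVectors_matrixA b)]
  exact tsum_congr fun x => ind_congr mem_partitionVectors_matrixA

/-- The edges of the complete graph are the pairs. -/
noncomputable def pairIndexEquivEdgeSet (n : ℕ) :
    PairIndex n ≃ (⊤ : SimpleGraph (Fin n)).edgeSet :=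
  Equiv.ofBijective (fun p => ⟨s(p.1.1, p.1.2), p.2.ne⟩) (by
    constructor
    · rintro ⟨⟨i, j⟩, h⟩ ⟨⟨i', j'⟩, h'⟩ hh
      rcases Sym2.eq_iff.1 (congrArg Subtype.val hh) with ⟨h1, h2⟩ | ⟨h1, h2⟩
      · exact Subtype.ext (Prod.ext h1 h2)
      · simp only at h h' h1 h2
        omega
    · rintro ⟨e, he⟩
      induction e with
      | h i j =>
        rcases lt_or_gt_of_ne (show i ≠ j from he) with h | h
        · exact ⟨⟨(i, j), h⟩, rfl⟩
        · exact ⟨⟨(j, i), h⟩, Subtype.ext Sym2.eq_swap⟩)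

theorem coe_pairIndexEquivEdgeSet {n : ℕ} (p : PairIndex n) :
    (pairIndexEquivEdgeSet n p : Sym2 (Fin n)) = s(p.1.1, p.1.2) := rfl

theorem sum_edgeSet_eq_pairDegree {n : ℕ} (x : PairIndex n → ℕ) (k : Fin n) :
    ∑ e : (⊤ : SimpleGraph (Fin n)).edgeSet,
      (if k ∈ (e : Sym2 (Fin n)) then (x ((pairIndexEquivEdgeSet n).symm e) : ℝ) else 0) =
      pairDegree x k := by
  rw [← (pairIndexEquivEdgeSet n).sum_comp, pairDegree, Nat.cast_sum]
  refine Finset.sum_congr rfl fun p _ => ?_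
  simp [coe_pairIndexEquivEdgeSet]

theorem latticePoints_eq_image {n : ℕ} (b : Fin n → ℕ) :
    latticePoints (perfectMatchingPolytope (⊤ : SimpleGraph (Fin n)) b) =
      (fun x e => (x ((pairIndexEquivEdgeSet n).symm e) : ℝ)) ''
        partitionVectors (matrixA n) (fun i => (b i : ℤ)) := by
  ext y
  constructor
  · rintro ⟨⟨h0, hy⟩, hz⟩
    -- Nonnegative integer coordinates are natural numbers, so a lattice point is a multiplicity
    -- vector.
    have hnat : ∀ e, ∃ m : ℕ, y e = m := by
      intro e
      obtain ⟨z, h⟩ := hz e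
      have := h0 e
      rw [h] at this ⊢
      lift z to ℕ using by exact_mod_cast this
      exact ⟨z, by simp⟩
    choose m hm using hnat
    have hym : y = fun e => ((fun p => m (pairIndexEquivEdgeSet n p))
        ((pairIndexEquivEdgeSet n).symm e) : ℝ) := by
      funext e
      simp [hm]
    refine ⟨fun p => m (pairIndexEquivEdgeSet n p), ?_, hym.symm⟩
    refine mem_partitionVectors_matrixA.2 fun k => ?_
    have := hy k
    rw [hym] at this
    exact_mod_cast (sum_edgeSet_eq_pairDegree (fun p => m (pairIndexEquivEdgeSet n p)) k).symm.trans
      this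
  · rintro ⟨x, hx, rfl⟩
    refine ⟨⟨fun e => Nat.cast_nonneg _, fun k => ?_⟩, fun e => ⟨x _, by simp; rfl⟩⟩
    rw [sum_edgeSet_eq_pairDegree, mem_partitionVectors_matrixA.1 hx]

theorem injective_edgeSet_coe (n : ℕ) : Function.Injective
    fun (x : PairIndex n → ℕ) (e : (⊤ : SimpleGraph (Fin n)).edgeSet) =>
      (x ((pairIndexEquivEdgeSet n).symm e) : ℝ) := by
  intro x x' h
  funext p
  simpa using congrFun h (pairIndexEquivEdgeSet n p)

end CompleteGraph

end ConformalCounting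

open ConformalCounting
theorem theorem3p2 (K : Type*) [Field K] [CharZero K] (n : ℕ) (b : Fin n → ℕ) :
    -- the dimension and the two counts are finite
    Module.Finite K (gradedPiece K (matrixA n) (fun i => (b i : ℤ))) ∧
    (partitionVectors (matrixA n) (fun i => (b i : ℤ))).Finite ∧
    (latticePoints (perfectMatchingPolytope (⊤ : SimpleGraph (Fin n)) b)).Finite ∧
    -- they agree with each other and with the sum of Kostka numbers
    hilbertFunction K (matrixA n) (fun i => (b i : ℤ)) =
      vectorPartitionFunction (matrixA n) (fun i => (b i : ℤ)) ∧
    vectorPartitionFunction (matrixA n) (fun i => (b i : ℤ)) =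
      (latticePoints (perfectMatchingPolytope (⊤ : SimpleGraph (Fin n)) b)).ncard ∧
    hilbertFunction K (matrixA n) (fun i => (b i : ℤ)) =
      ∑ μ ∈ evenConjugatePartitions (∑ i, b i), kostka μ b := by
  have hfin := finite_partitionVectors_matrixA b
  refine ⟨finite_gradedPiece K hfin, hfin, ?_, hilbertFunction_eq_vectorPartitionFunction K _ _,
    ?_, ?_⟩
  · rw [latticePoints_eq_image]
    exact hfin.image _
  · rw [latticePoints_eq_image, Set.ncard_image_of_injective _ (injective_edgeSet_coe n)]
    rfl
  · rw [hilbertFunction_eq_vectorPartitionFunction]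
    exact vectorPartitionFunction_matrixA_eq_sum_kostka b
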